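/- Let $k$ be a field. Let $\Lambda^{\max}$ be the field of formal series $a=\sum_{\gamma\in\mathbb R}a_\gamma T^\gamma$ with $a_\gamma\in k$ whose support $\{\gamma\in\mathbb R: a_\gamma\neq 0\}$ is well-ordered, and let $\Lambda^{\min}\subseteq\Lambda^{\max}$ be the subfield of those series that can be written $\sum_{i=1}^\infty a_iT^{\gamma_i}$ with $\lim_{i\to\infty}\gamma_i=+\infty$. Both carry the valuation $v$ given by the least exponent in the support, with $v(0)=+\infty$. A valued field is a field $K$ with a valuation $v:K\to(-\infty,+\infty]$; its residue field is $\{v\ge 0\}/\{v>0\}$, its value group is $v(K\setminus\{0\})\subseteq\mathbb R$, and it is complete if it is complete for the absolute value $|a|=e^{-v(a)}$. (i) If $k$ is perfect, then $\Lambda^{\min}$ and $\Lambda^{\max}$ are both perfect. (ii) $\Lambda^{\max}$ is maximal in Krull's sense: if $K$ is a valued field extension of $\Lambda^{\max}$ with value group $\mathbb R$, such that the natural map from $k$ to the residue field of $K$ is an isomorphism, then $K=\Lambda^{\max}$. In particular, if $k$ is algebraically closed, so is $\Lambda^{\max}$. (iii) If $k$ is algebraically closed of characteristic $0$, then $\Lambda^{\min}$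 is algebraically closed. If $k$ has positive characteristic $p$, then $\Lambda^{\min}$ is not algebraically closed; moreover the valuation of $\Lambda^{\min}$ extends uniquely to a valuation on its algebraic closure with values in $(-\infty,+\infty]$, and the algebraic closure is not complete with respect to it. -/

import Mathlib

noncomputable section

namespace Novikov

open Filter HahnSeries

/-! ### Real-valued valued fields

A valuation `K → (-∞, +∞]` is an `AddValuation K (WithTop ℝ)`; on a field `v a = ⊤ ↔ a = 0`
is automatic. -/

section Valued

variable {K : Type*} [Field K]

/-- The ring of integers `K⁰ = {a | 0 ≤ v a}`, see `mem_integerRing`. -/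
def integerRing (v : AddValuation K (WithTop ℝ)) : ValuationSubring K :=
  v.toValuation.valuationSubring

theorem mem_integerRing (v : AddValuation K (WithTop ℝ)) (a : K) :
    a ∈ integerRing v ↔ 0 ≤ v a :=
  Iff.rfl

/-- The residue field `K⁰ / K⁺`, where `K⁺` is the maximal ideal of `K⁰`. -/
abbrev ResidueField (v : AddValuation K (WithTop ℝ)) : Type _ :=
  IsLocalRing.ResidueField (integerRing v)

/-- The value group `v (K \ {0})`, as a subset of `ℝ`. -/
def valueGroup (v : AddValuation K (WithTop ℝ)) : Set ℝ :=
  {r | ∃ a : K, a ≠ 0 ∧ v a = (r : WithTop ℝ)}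

/-- The absolute value `|a| = exp (-v a)`, with `|0| = 0`. -/
def absVal (v : AddValuation K (WithTop ℝ)) (a : K) : ℝ :=
  open Classical in if a = 0 then 0 else Real.exp (-(v a).untopD 0)

/-- A valued field is complete if every Cauchy sequence for `|a - b|` converges. -/
def IsCompleteValued (v : AddValuation K (WithTop ℝ)) : Prop :=
  ∀ u : ℕ → K,
    (∀ ε : ℝ, 0 < ε → ∃ N : ℕ, ∀ m n : ℕ, N ≤ m → N ≤ n → absVal v (u m - u n) < ε) →
    ∃ a : K, ∀ ε : ℝ, 0 < ε → ∃ N : ℕ, ∀ n : ℕ, N ≤ n → absVal v (u n - a) < ε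

/-- `(K, w)` is a valued field extension of `(F, v)` through the field homomorphism `i`. -/
def IsValuedExtension {F : Type*} [Field F] (v : AddValuation F (WithTop ℝ))
    (w : AddValuation K (WithTop ℝ)) (i : F →+* K) : Prop :=
  ∀ a : F, w (i a) = v a

end Valued

/-! ### The two Novikov fields -/

section Fields

variable (k : Type*) [Field k]

/-- `Λ^max`: formal sums `∑ a_γ T^γ` with real exponents and well-ordered support. -/
abbrev LambdaMax : Type _ := HahnSeries ℝ k

/-- The valuation of `Λ^max`: the least exponent in the support, `⊤` for the zero series. -/
abbrev valMax : AddValuation (LambdaMax k) (WithTop ℝ) := HahnSeries.addVal ℝ k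

variable {k}

/-- Below every bound the series has only finitely many exponents; equivalently, it is of the form
`∑ i, a_i T^(γ_i)` with `γ_i → +∞`, see `halfFinite_iff_exists_series`. -/
def HalfFinite (x : LambdaMax k) : Prop :=
  ∀ c : ℝ, (x.support ∩ Set.Iio c).Finite

theorem halfFinite_iff_exists_series (x : LambdaMax k) :
    HalfFinite x ↔ ∃ (a : ℕ → k) (γ : ℕ → ℝ), Tendsto γ atTop atTop ∧
      ∀ c : ℝ, x.coeff c = ∑ᶠ (i : ℕ) (_ : γ i = c), a i := by
  classical
  constructor
  · intro hx
    have hcount : x.support.Countable := by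
      have : x.support ⊆ ⋃ n : ℕ, (x.support ∩ Set.Iio (n : ℝ)) := by
        intro g hg
        obtain ⟨n, hn⟩ := exists_nat_gt g
        exact Set.mem_iUnion.2 ⟨n, hg, hn⟩
      exact (Set.countable_iUnion fun n : ℕ => (hx n).countable).mono this
    have : Countable x.support := hcount.to_subtype
    obtain ⟨e, he⟩ := exists_injective_nat x.support
    refine ⟨fun i => if h : ∃ s, e s = i then x.coeff h.choose else 0,
      fun i => if h : ∃ s, e s = i then (h.choose : ℝ) else i, ?_, ?_⟩
    · rw [tendsto_atTop]
      intro c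
      rw [← Nat.cofinite_eq_atTop, eventually_cofinite]
      refine (((hx c).preimage (Subtype.val_injective.injOn)).image e |>.union
        (Set.finite_lt_nat (⌈c⌉₊))).subset ?_
      intro i hi
      simp only [Set.mem_ofPred_eq, not_le] at hi
      by_cases h : ∃ s, e s = i
      · rw [dif_pos h] at hi
        exact Or.inl ⟨h.choose, ⟨h.choose.2, hi⟩, h.choose_spec⟩
      · rw [dif_neg h] at hi
        exact Or.inr (Nat.lt_ceil.2 hi)
    · intro c
      by_cases hc : c ∈ x.support
      · have h0 : ∃ s, e s = e ⟨c, hc⟩ := ⟨_, rfl⟩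
        have h1 : h0.choose = ⟨c, hc⟩ := he h0.choose_spec
        rw [finsum_eq_single _ (e ⟨c, hc⟩)]
        · beta_reduce
          rw [finsum_eq_if, if_pos (by rw [dif_pos h0, h1]), dif_pos h0, h1]
        · intro n hn
          rw [finsum_eq_if]
          beta_reduce
          by_cases h3 : ∃ s, e s = n
          · rw [if_neg]
            rw [dif_pos h3]
            intro h2
            apply hn
            rw [← h3.choose_spec]
            congr 1
            exact Subtype.ext h2
          · rw [dif_neg h3, dif_neg h3, ite_self]
      · rw [finsum_eq_zero_of_forall_eq_zero]
        · simpa using hc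
        · intro i
          rw [finsum_eq_if]
          beta_reduce
          by_cases h3 : ∃ s, e s = i
          · rw [if_neg]
            rw [dif_pos h3]
            intro h2
            exact hc (h2 ▸ h3.choose.2)
          · rw [dif_neg h3, dif_neg h3, ite_self]
  · rintro ⟨a, γ, hγ, hx⟩ c
    have hfin : {i | γ i < c}.Finite := by
      have := (tendsto_atTop.1 hγ) c
      rw [← Nat.cofinite_eq_atTop, eventually_cofinite] at this
      simpa using this
    refine (hfin.image γ).subset ?_
    rintro g ⟨hg, hgc⟩
    by_contra hcon
    apply hg
    rw [hx g]
    apply finsum_eq_zero_of_forall_eq_zero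
    intro i
    rw [finsum_eq_if, if_neg]
    rintro rfl
    exact hcon ⟨i, hgc, rfl⟩

theorem HalfFinite.single (g : ℝ) (r : k) : HalfFinite (HahnSeries.single g r) := fun _ =>
  (Set.finite_singleton g).subset fun _ hx => support_single_subset hx.1

theorem HalfFinite.add {x y : LambdaMax k} (hx : HalfFinite x) (hy : HalfFinite y) :
    HalfFinite (x + y) := fun c =>
  ((hx c).union (hy c)).subset fun _ hg =>
    ((support_add_subset x y) hg.1).imp (fun h => ⟨h, hg.2⟩) fun h => ⟨h, hg.2⟩

theorem HalfFinite.neg {x : LambdaMax k} (hx : HalfFinite x) : HalfFinite (-x) := by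
  intro c
  rw [support_neg]
  exact hx c

theorem HalfFinite.mul {x y : LambdaMax k} (hx : HalfFinite x) (hy : HalfFinite y) :
    HalfFinite (x * y) := by
  intro c
  refine ((hx (c - y.order)).image2 (· + ·) (hy (c - x.order))).subset ?_
  rintro g ⟨hg, hgc⟩
  obtain ⟨i, hi, j, hj, rfl⟩ := support_mul_subset hg
  have h1 := order_le_of_coeff_ne_zero hi
  have h2 := order_le_of_coeff_ne_zero hj
  simp only [Set.mem_Iio] at hgc
  exact ⟨i, ⟨hi, by simp only [Set.mem_Iio]; linarith⟩,
    j, ⟨hj, by simp only [Set.mem_Iio]; linarith⟩, rfl⟩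

theorem HalfFinite.pow {x : LambdaMax k} (hx : HalfFinite x) (n : ℕ) : HalfFinite (x ^ n) := by
  induction n with
  | zero => rw [pow_zero]; exact HalfFinite.single 0 1
  | succ n ih => rw [pow_succ]; exact ih.mul hx

theorem HalfFinite.hsum_powers {y : LambdaMax k} (hy : HalfFinite y) :
    HalfFinite (SummableFamily.powers y).hsum := by
  intro c
  by_cases hpos : 0 < y.orderTop
  · by_cases hy0 : y = 0
    · subst hy0
      rw [SummableFamily.powers_zero, SummableFamily.hsum_single]
      exact HalfFinite.single 0 1 c
    have hδ : 0 < y.order := (zero_lt_orderTop_iff hy0).1 hpos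
    obtain ⟨N, hN⟩ := exists_nat_gt (c / y.order)
    refine (Set.Finite.biUnion (Set.finite_lt_nat N) fun n _ => hy.pow n c).subset ?_
    rintro g ⟨hg, hgc⟩
    have : ∃ n, (y ^ n).coeff g ≠ 0 := by
      by_contra! hcon
      apply hg
      rw [SummableFamily.coeff_hsum]
      apply finsum_eq_zero_of_forall_eq_zero
      intro n
      rw [SummableFamily.powers_of_orderTop_pos hpos]
      exact hcon n
    obtain ⟨n, hn⟩ := this
    refine Set.mem_biUnion (x := n) ?_ ⟨hn, hgc⟩
    have h1 := order_le_of_coeff_ne_zero hn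
    rw [order_pow, nsmul_eq_mul] at h1
    simp only [Set.mem_Iio] at hgc
    have h2 : (n : ℝ) < N := by
      refine lt_trans ?_ hN
      rw [lt_div_iff₀ hδ]
      linarith
    exact_mod_cast h2
  · rw [SummableFamily.powers_of_not_orderTop_pos hpos, SummableFamily.hsum_single]
    exact HalfFinite.single 0 1 c

theorem HalfFinite.inv {x : LambdaMax k} (hx : HalfFinite x) : HalfFinite x⁻¹ := by
  rw [inv_def]
  refine (HalfFinite.single _ _).mul (HalfFinite.hsum_powers ?_)
  rw [sub_eq_add_neg]
  exact (HalfFinite.single 0 1).add ((HalfFinite.single _ _).mul hx).neg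

variable (k)

/-- `Λ^min`, as a subfield of `Λ^max`: the series `∑ i, a_i T^(γ_i)` with `γ_i → +∞`. -/
def LambdaMin : Subfield (LambdaMax k) where
  carrier := {x | HalfFinite x}
  mul_mem' := HalfFinite.mul
  one_mem' := HalfFinite.single 0 1
  add_mem' := HalfFinite.add
  zero_mem' := by
    intro c
    simp
  neg_mem' := HalfFinite.neg
  inv_mem' _ := HalfFinite.inv

/-- The valuation of `Λ^min`, restricted from `Λ^max`. -/
def valMin : AddValuation (LambdaMin k) (WithTop ℝ) :=
  (valMax k).comap (LambdaMin k).subtype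

variable {k}

/-- For a valued field extension `K` of `Λ^max`, the natural map `k → K⁰ / K⁺` sending a
coefficient to the class of the corresponding constant series. -/
def coeffToResidue {K : Type*} [Field K] (w : AddValuation K (WithTop ℝ))
    (i : LambdaMax k →+* K) (hi : IsValuedExtension (valMax k) w i) : k →+* ResidueField w :=
  (IsLocalRing.residue (integerRing w)).comp
    ((i.comp HahnSeries.C).codRestrict (integerRing w) fun c => by
      rw [mem_integerRing, RingHom.comp_apply, hi, HahnSeries.addVal_apply]
      by_cases hc : c = 0
      · simp [hc]
      · exact (HahnSeries.orderTop_single (Γ := ℝ) (a := 0) hc).ge)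

end Fields

end Novikov

end

noncomputable section

namespace Novikov

open Filter HahnSeries
open scoped Pointwise


/-! ### Frobenius on Hahn series -/

section Frobenius

variable {k : Type*} [Field k]

/-! In characteristic `p` the Frobenius acts on Hahn series term by term (`coeff_pow_char`), so
`p`-th roots can be taken term by term too, which gives perfectness.

For maximality, the series approximating a given element of `K` to various accuracies agree on
initial segments. They glue to a series `y` at least as good as all of them, and an immediate
extension would allow a further improvement unless `y` is the element itself
(`surjective_of_immediate`).

Both fields are complete, so the valuation extends uniquely to the algebraic closure as the spectral
norm (`exists_unique_extension`). If `k` is algebraically closed, this extension is immediate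
(`exists_val_lt_val_sub`). Maximality then settles `Λ^max`; for `Λ^min` in characteristic zero,
subtracting the mean of the conjugates contradicts immediateness
(`algebraMap_surjective_of_immediate`).

In characteristic `p`, solving `y ^ p - y = T ^ (-r)` with `r > 0` forces infinitely many negative
exponents, so `Λ^min` has no solution. Infinitely many such equations have linearly independent
roots `α m`. If `∑ T ^ m * α m` converged in the algebraic closure, its sum would have conjugates at
infinitely many distances from it, although it is algebraic. -/

instance charP_lambdaMax (p : ℕ) [CharP k p] : CharP (LambdaMax k) p :=
  charP_of_injective_ringHom (C_injective (Γ := ℝ) (R := k)) p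

/-- The bound `Q` depends only on `S` and `n`. In `coeff_pow_char` it is fixed first and then
applied to a remainder whose construction uses `Q`. -/
theorem exists_isPWO_support_pow {S : Set ℝ} (hS : S.IsPWO) (n : ℕ) :
    ∃ Q : Set ℝ, Q.IsPWO ∧ ∀ r : LambdaMax k, r.support ⊆ S → (r ^ n).support ⊆ Q := by
  induction n with
  | zero =>
    refine ⟨{0}, Set.isPWO_singleton 0, fun r _ => ?_⟩
    rw [pow_zero]
    exact support_single_subset
  | succ n ih =>
    obtain ⟨Q, hQ, h⟩ := ih
    refine ⟨Q + S, hQ.add hS, fun r hr => ?_⟩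
    rw [pow_succ]
    exact support_mul_subset.trans (Set.add_subset_add (h r hr) hr)

theorem coeff_sum_single (T : Finset ℝ) (x : ℝ → k) (g : ℝ) :
    (∑ t ∈ T, single t (x t) : LambdaMax k).coeff g = if g ∈ T then x g else 0 := by
  classical
  rw [coeff_sum, ← Finset.sum_ite_eq T g x]
  refine Finset.sum_congr rfl fun t _ => ?_
  rw [coeff_single]

/-- In characteristic `p`, the `p`-th power of a Hahn series is computed termwise. -/
theorem coeff_pow_char (p : ℕ) [Fact p.Prime] [CharP k p] (x : LambdaMax k) (δ : ℝ) :
    (x ^ p).coeff δ = x.coeff (δ / p) ^ p := by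
  classical
  have hp : p ≠ 0 := (Fact.out : p.Prime).ne_zero
  have hpR : (p : ℝ) ≠ 0 := Nat.cast_ne_zero.2 hp
  obtain ⟨Q, hQ, h⟩ := exists_isPWO_support_pow (k := k) x.isPWO_support (p - 1)
  have hfin := (Set.AddAntidiagonal.finite_of_isPWO x.isPWO_support hQ δ).image Prod.fst
  -- `T` contains every exponent of `x` that can be completed to `δ` by an element of `Q`. Deleting
  -- these finitely many terms from `x` leaves a remainder whose `p`-th power has no term at `δ`.
  set T : Finset ℝ := insert (δ / p) hfin.toFinset with hT
  set s : LambdaMax k := ∑ t ∈ T, single t (x.coeff t) with hs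
  have hr : ∀ g, (x - s).coeff g = if g ∈ T then 0 else x.coeff g := by
    intro g
    rw [coeff_sub, hs, coeff_sum_single]
    split_ifs <;> simp
  have hsupp : (x - s).support ⊆ x.support := by
    intro g hg
    rw [mem_support, hr] at hg
    split_ifs at hg with h1
    · exact absurd rfl hg
    · exact hg
  have hzero : ((x - s) ^ p).coeff δ = 0 := by
    by_contra hne
    have hmem : δ ∈ ((x - s) ^ p).support := hne
    rw [← Nat.sub_add_cancel (Nat.one_le_iff_ne_zero.2 hp), pow_succ'] at hmem
    obtain ⟨i, hi, j, hj, hij⟩ := support_mul_subset hmem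
    have hiT : i ∈ T := by
      rw [hT, Finset.mem_insert, Set.Finite.mem_toFinset]
      exact Or.inr ⟨(i, j), ⟨hsupp hi, h _ hsupp hj, hij⟩, rfl⟩
    rw [mem_support, hr, if_pos hiT] at hi
    exact hi rfl
  have hx : x ^ p = (x - s) ^ p + s ^ p := by
    rw [← add_pow_char, sub_add_cancel]
  have hsp : s ^ p = ∑ t ∈ T, single (p • t) (x.coeff t ^ p) := by
    rw [hs, sum_pow_char]
    exact Finset.sum_congr rfl fun t _ => single_pow _ _ _
  rw [hx, coeff_add, hzero, zero_add, hsp, coeff_sum, Finset.sum_eq_single (δ / p)]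
  · rw [nsmul_eq_mul, mul_div_cancel₀ _ hpR, coeff_single_same]
  · intro t _ ht
    rw [coeff_single_of_ne]
    rintro rfl
    apply ht
    rw [nsmul_eq_mul, mul_div_cancel_left₀ _ hpR]
  · intro hn
    exact absurd (Finset.mem_insert_self _ _) hn

/-- The root has coefficients `x_(g p) ^ (1 / p)`. The support condition is what keeps the root of
an element of `Λ^min` in `Λ^min`. -/
theorem exists_pow_char_eq (p : ℕ) [Fact p.Prime] [CharP k p] [PerfectRing k p]
    (x : LambdaMax k) :
    ∃ y : LambdaMax k, y ^ p = x ∧ ∀ g, g ∈ y.support → g * p ∈ x.support := by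
  have hpR : (p : ℝ) ≠ 0 := Nat.cast_ne_zero.2 (Fact.out : p.Prime).ne_zero
  have hsub : Function.support (fun g : ℝ => (frobeniusEquiv k p).symm (x.coeff (g * p))) ⊆
      (fun t : ℝ => t / p) '' x.support := by
    intro g hg
    refine ⟨g * p, fun h0 => hg ?_, mul_div_cancel_right₀ _ hpR⟩
    beta_reduce
    rw [h0, map_zero]
  have hmono : Monotone fun t : ℝ => t / p := fun a b hab =>
    div_le_div_of_nonneg_right hab (Nat.cast_nonneg p)
  obtain ⟨y, hy⟩ : ∃ y : LambdaMax k,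
      ∀ g, y.coeff g = (frobeniusEquiv k p).symm (x.coeff (g * p)) :=
    ⟨⟨_, Set.IsPWO.mono (x.isPWO_support.image_of_monotone hmono) hsub⟩, fun _ => rfl⟩
  refine ⟨y, ?_, fun g hg h0 => hg ?_⟩
  · ext δ
    rw [coeff_pow_char, hy, div_mul_cancel₀ _ hpR, frobeniusEquiv_symm_pow_p]
  · rw [hy, h0, map_zero]

theorem perfectField_lambdaMax [PerfectField k] : PerfectField (LambdaMax k) := by
  obtain ⟨p, hp⟩ := CharP.exists k
  rcases CharP.char_is_prime_or_zero k p with h | rfl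
  · have : Fact p.Prime := ⟨h⟩
    have : PerfectRing (LambdaMax k) p := PerfectRing.ofSurjective _ p fun x => by
      obtain ⟨y, hy, -⟩ := exists_pow_char_eq p x
      exact ⟨y, hy⟩
    exact PerfectRing.toPerfectField _ p
  · have : CharZero (LambdaMax k) := CharP.charP_to_charZero _
    infer_instance

theorem perfectField_lambdaMin [PerfectField k] : PerfectField (LambdaMin k) := by
  obtain ⟨p, hp⟩ := CharP.exists k
  rcases CharP.char_is_prime_or_zero k p with h | rfl
  · have : Fact p.Prime := ⟨h⟩
    have hpR : (0 : ℝ) < p := Nat.cast_pos.2 h.pos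
    have : PerfectRing (LambdaMin k) p := PerfectRing.ofSurjective _ p fun x => by
      obtain ⟨y, hy, hs⟩ := exists_pow_char_eq p (x : LambdaMax k)
      refine ⟨⟨y, fun c => ?_⟩, Subtype.ext hy⟩
      refine Set.Finite.subset ((x.2 (c * p)).image fun t : ℝ => t / p) ?_
      rintro g ⟨hg, hgc⟩
      exact ⟨g * p, ⟨hs g hg, mul_lt_mul_of_pos_right hgc hpR⟩, mul_div_cancel_right₀ _ hpR.ne'⟩
    exact PerfectRing.toPerfectField _ p
  · have : CharZero (LambdaMax k) := CharP.charP_to_charZero _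
    infer_instance

/-- If `y ^ p - y` vanishes at the other points of `{-r * p ^ j}`, then it vanishes at `-r`. -/
theorem HalfFinite.coeff_pow_char_sub_self (p : ℕ) [Fact p.Prime] [CharP k p]
    {y : LambdaMax k} (hy : HalfFinite y) {r : ℝ} (hr : 0 < r)
    (h₁ : ∀ j : ℕ, (y ^ p - y).coeff (-r / p ^ (j + 1)) = 0)
    (h₂ : ∀ j : ℕ, (y ^ p - y).coeff (-r * p ^ (j + 1)) = 0) :
    (y ^ p - y).coeff (-r) = 0 := by
  have hp1 : (1 : ℝ) < p := Nat.one_lt_cast.2 (Fact.out : p.Prime).one_lt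
  have hp0 : (0 : ℝ) < p := zero_lt_one.trans hp1
  have key : ∀ f : ℕ → ℝ, Function.Injective f → (∀ j, f j < 0) →
      ¬ ∀ j, y.coeff (f j) ≠ 0 := by
    intro f hf hneg hne
    exact Set.infinite_of_injective_forall_mem hf (s := y.support ∩ Set.Iio 0)
      (fun j => ⟨hne j, hneg j⟩) (hy 0)
  have hinj : Function.Injective fun j : ℕ => (p : ℝ) ^ j := pow_right_injective₀ hp0 hp1.ne'
  simp only [coeff_sub, coeff_pow_char] at h₁ h₂ ⊢
  -- A nonzero coefficient here propagates through `h₁` to all `-r / p ^ (j + 1)`, infinitely many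
  -- negative exponents.
  have ha : y.coeff (-r / p) = 0 := by
    by_contra hne
    refine key (fun j => -r / p ^ (j + 1)) (fun i j hij => ?_) (fun j => ?_) fun j => ?_
    · have := hinj (inv_injective (mul_left_cancel₀ (neg_ne_zero.2 hr.ne')
        (by simpa only [div_eq_mul_inv] using hij)))
      exact Nat.succ_injective this
    · exact div_neg_of_neg_of_pos (neg_lt_zero.2 hr) (pow_pos hp0 _)
    · induction j with
      | zero => simpa using hne
      | succ j ih =>
        intro h0
        apply ih
        have := h₁ j
        rw [div_div, ← pow_succ, h0, zero_pow (Fact.out : p.Prime).ne_zero, zero_sub,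
          neg_eq_zero] at this
        exact this
  rw [ha, zero_pow (Fact.out : p.Prime).ne_zero, zero_sub, neg_eq_zero]
  -- Likewise `h₂` propagates a nonzero coefficient at `-r` to all `-r * p ^ j`.
  by_contra hne
  refine key (fun j => -r * p ^ j) (fun i j hij => ?_) (fun j => ?_) fun j => ?_
  · exact hinj (mul_left_cancel₀ (neg_ne_zero.2 hr.ne') hij)
  · exact mul_neg_of_neg_of_pos (neg_lt_zero.2 hr) (pow_pos hp0 _)
  · induction j with
    | zero => simpa using hne
    | succ j ih =>
      intro h0
      have := h₂ j
      rw [h0, sub_zero, pow_succ, ← mul_assoc, mul_div_cancel_right₀ _ hp0.ne'] at this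
      exact ih (eq_zero_of_pow_eq_zero this)

end Frobenius


/-! ### The absolute value of a valued field -/

section AbsVal

variable {K : Type*} [Field K] (v : AddValuation K (WithTop ℝ))

theorem exists_val_eq_coe {a : K} (ha : a ≠ 0) : ∃ r : ℝ, v a = r := by
  obtain ⟨r, hr⟩ := WithTop.ne_top_iff_exists.1 (mt v.top_iff.1 ha)
  exact ⟨r, hr.symm⟩

theorem absVal_zero : absVal v 0 = 0 := if_pos rfl

theorem absVal_of_val_eq {a : K} {r : ℝ} (h : v a = r) : absVal v a = Real.exp (-r) := by
  have ha : a ≠ 0 := by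
    rintro rfl
    rw [v.map_zero] at h
    exact WithTop.top_ne_coe h
  rw [absVal, if_neg ha, h, WithTop.untopD_coe]

theorem absVal_nonneg (a : K) : 0 ≤ absVal v a := by
  unfold absVal
  split_ifs <;> positivity

theorem absVal_le_absVal {a : K} {L : Type*} [Field L] {w : AddValuation L (WithTop ℝ)} {b : L} :
    absVal v a ≤ absVal w b ↔ w b ≤ v a := by
  by_cases ha : a = 0
  · subst ha
    simp [absVal_zero, absVal_nonneg]
  obtain ⟨r, hr⟩ := exists_val_eq_coe v ha
  rw [absVal_of_val_eq v hr, hr]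
  by_cases hb : b = 0
  · subst hb
    simp [absVal_zero, Real.exp_pos]
  obtain ⟨s, hs⟩ := exists_val_eq_coe w hb
  rw [absVal_of_val_eq w hs, hs, Real.exp_le_exp, neg_le_neg_iff, WithTop.coe_le_coe]

theorem absVal_lt_exp_neg {a : K} {c : ℝ} : absVal v a < Real.exp (-c) ↔ (c : WithTop ℝ) < v a := by
  by_cases ha : a = 0
  · subst ha
    simp [absVal_zero, Real.exp_pos]
  obtain ⟨r, hr⟩ := exists_val_eq_coe v ha
  rw [absVal_of_val_eq v hr, hr, Real.exp_lt_exp, neg_lt_neg_iff, WithTop.coe_lt_coe]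

theorem absVal_mul (a b : K) : absVal v (a * b) = absVal v a * absVal v b := by
  by_cases ha : a = 0
  · simp [ha, absVal_zero]
  by_cases hb : b = 0
  · simp [hb, absVal_zero]
  obtain ⟨r, hr⟩ := exists_val_eq_coe v ha
  obtain ⟨s, hs⟩ := exists_val_eq_coe v hb
  have h : v (a * b) = ((r + s : ℝ) : WithTop ℝ) := by rw [v.map_mul, hr, hs, WithTop.coe_add]
  rw [absVal_of_val_eq v hr, absVal_of_val_eq v hs, absVal_of_val_eq v h, neg_add, Real.exp_add]

theorem absVal_add_le_max (a b : K) : absVal v (a + b) ≤ max (absVal v a) (absVal v b) := by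
  rcases min_le_iff.1 (v.map_add a b) with h | h
  · exact le_max_of_le_left ((absVal_le_absVal v).2 h)
  · exact le_max_of_le_right ((absVal_le_absVal v).2 h)

/-- `absVal v` as a bundled absolute value. -/
def absoluteValue : AbsoluteValue K ℝ where
  toFun := absVal v
  map_mul' := absVal_mul v
  nonneg' := absVal_nonneg v
  eq_zero' a := by
    refine ⟨fun h => ?_, fun h => h ▸ absVal_zero v⟩
    by_contra ha
    obtain ⟨r, hr⟩ := exists_val_eq_coe v ha
    rw [absVal_of_val_eq v hr] at h
    exact (Real.exp_pos _).ne' h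
  add_le' a b := (absVal_add_le_max v a b).trans
    (max_le_add_of_nonneg (absVal_nonneg v a) (absVal_nonneg v b))

theorem absoluteValue_apply (a : K) : absoluteValue v a = absVal v a := rfl

theorem val_pos_of_mem_maximalIdeal {a : integerRing v}
    (h : a ∈ IsLocalRing.maximalIdeal (integerRing v)) : 0 < v a := by
  refine lt_of_le_of_ne ((mem_integerRing v _).1 a.2) fun h0 => ?_
  have ha : (a : K) ≠ 0 := by
    intro ha
    rw [ha, v.map_zero] at h0
    exact WithTop.zero_ne_top h0
  have hinv : (a : K)⁻¹ ∈ integerRing v := by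
    have h1 : v ((a : K) * (a : K)⁻¹) = 0 := by rw [mul_inv_cancel₀ ha, v.map_one]
    rw [v.map_mul, ← h0, zero_add] at h1
    exact (mem_integerRing v _).2 h1.ge
  exact (IsLocalRing.mem_maximalIdeal _).1 h
    (IsUnit.of_mul_eq_one ⟨_, hinv⟩ (Subtype.ext (mul_inv_cancel₀ ha)))

theorem isCompleteValued_iff : IsCompleteValued v ↔ ∀ u : ℕ → K,
    (∀ c : ℝ, ∃ N : ℕ, ∀ m n : ℕ, N ≤ m → N ≤ n → (c : WithTop ℝ) < v (u m - u n)) →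
    ∃ a : K, ∀ c : ℝ, ∃ N : ℕ, ∀ n : ℕ, N ≤ n → (c : WithTop ℝ) < v (u n - a) := by
  have key : ∀ P : ℝ → Prop, (∀ ε, 0 < ε → P ε) ↔ ∀ c : ℝ, P (Real.exp (-c)) := fun P =>
    ⟨fun h c => h _ (Real.exp_pos _), fun h ε hε => by
      simpa [Real.exp_log hε] using h (-Real.log ε)⟩
  unfold IsCompleteValued
  simp only [key, absVal_lt_exp_neg]

end AbsVal

/-! ### Gluing Hahn series, completeness and maximality -/

section Glue

variable {k : Type*} [Field k]

theorem lt_valMax_iff {x : LambdaMax k} {c : ℝ} :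
    (c : WithTop ℝ) < valMax k x ↔ ∀ g ≤ c, x.coeff g = 0 := by
  rw [addVal_apply]
  refine ⟨fun h g hg => coeff_eq_zero_of_lt_orderTop ((WithTop.coe_le_coe.2 hg).trans_lt h),
    fun h => ?_⟩
  by_contra! hc
  obtain ⟨r, hr⟩ := WithTop.ne_top_iff_exists.1 (ne_top_of_le_ne_top WithTop.coe_ne_top hc)
  rw [← hr, WithTop.coe_le_coe] at hc
  exact coeff_orderTop_ne hr.symm (h r hc)

theorem valMax_single {g : ℝ} {r : k} (hr : r ≠ 0) : valMax k (single g r) = g := by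
  rw [addVal_apply, orderTop_single hr]

/-- Hahn series whose initial segments are compatible can be glued. -/
theorem exists_glue (I : Set ℝ) (A : ℝ → LambdaMax k) (hI : ∀ g ∈ I, ∀ g' ≤ g, g' ∈ I)
    (hA : ∀ g ∈ I, ∀ g' ≤ g, (A g').coeff g' = (A g).coeff g') :
    ∃ y : LambdaMax k, ∀ g ∈ I, ∀ g' ≤ g, y.coeff g' = (A g).coeff g' := by
  classical
  -- A descending sequence stays below its first term `f 0`, where the glued coefficients are those
  -- of the single series `A (f 0)`.
  have hpwo : (Function.support fun g => if g ∈ I then (A g).coeff g else 0).IsPWO := by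
    rw [Set.isPWO_iff_isWF, Set.isWF_iff_no_descending_seq]
    intro f hf hsub
    have h0 := hsub 0
    have hfI : f 0 ∈ I := by
      by_contra h
      exact h0 (if_neg h)
    refine Set.isWF_iff_no_descending_seq.1 (A (f 0)).isWF_support f hf fun n => ?_
    have hle : f n ≤ f 0 := hf.antitone (Nat.zero_le n)
    have hn := hsub n
    rw [Function.mem_support, if_pos (hI _ hfI _ hle), hA _ hfI _ hle] at hn
    exact hn
  obtain ⟨y, hy⟩ : ∃ y : LambdaMax k, ∀ g, y.coeff g = if g ∈ I then (A g).coeff g else 0 :=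
    ⟨⟨_, hpwo⟩, fun _ => rfl⟩
  refine ⟨y, fun g hg g' hle => ?_⟩
  rw [hy, if_pos (hI g hg g' hle), hA g hg g' hle]

/-- The coefficients up to `c` are constant from index `N c` on, and these stable initial segments
glue. -/
theorem exists_limit (u : ℕ → LambdaMax k)
    (hu : ∀ c : ℝ, ∃ N : ℕ, ∀ m n : ℕ, N ≤ m → N ≤ n → (c : WithTop ℝ) < valMax k (u m - u n)) :
    ∃ a : LambdaMax k, ∀ c : ℝ, ∃ N : ℕ, ∀ n : ℕ, N ≤ n → (c : WithTop ℝ) < valMax k (u n - a) := by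
  choose N hN using hu
  have heq : ∀ c : ℝ, ∀ n, N c ≤ n → ∀ g ≤ c, (u n).coeff g = (u (N c)).coeff g := by
    intro c n hn g hg
    have := lt_valMax_iff.1 (hN c n (N c) hn le_rfl) g hg
    rwa [coeff_sub, sub_eq_zero] at this
  obtain ⟨y, hy⟩ := exists_glue Set.univ (fun g => u (N g)) (fun _ _ _ _ => trivial)
    fun g _ g' hle => by
      rw [← heq g' _ (le_max_left (N g') (N g)) g' le_rfl,
        ← heq g _ (le_max_right (N g') (N g)) g' hle]
  refine ⟨y, fun c => ⟨N c, fun n hn => lt_valMax_iff.2 fun g hg => ?_⟩⟩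
  rw [coeff_sub, hy c trivial g hg, heq c n hn g hg, sub_self]

theorem isCompleteValued_valMax : IsCompleteValued (valMax k) :=
  (isCompleteValued_iff _).2 exists_limit

/-- `Λ^min` is closed in `Λ^max`: below any `c` the limit has the same coefficients as some term of
the sequence, hence finitely many exponents. -/
theorem isCompleteValued_valMin : IsCompleteValued (valMin k) := by
  refine (isCompleteValued_iff _).2 fun u hu => ?_
  obtain ⟨a, ha⟩ := exists_limit (fun n => (u n : LambdaMax k)) hu
  refine ⟨⟨a, fun c => ?_⟩, ha⟩
  obtain ⟨N, hN⟩ := ha c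
  refine ((u N).2 c).subset ?_
  rintro g ⟨hg, hgc⟩
  refine ⟨fun h0 => hg ?_, hgc⟩
  have := lt_valMax_iff.1 (hN N le_rfl) g (le_of_lt hgc)
  rwa [coeff_sub, h0, zero_sub, neg_eq_zero] at this

/-- If every nonzero element of `K` is approximated by one of `Λ^max`, then `K = Λ^max`. -/
theorem surjective_of_immediate {K : Type*} [Field K] (w : AddValuation K (WithTop ℝ))
    (i : LambdaMax k →+* K) (hi : IsValuedExtension (valMax k) w i)
    (himm : ∀ x : K, x ≠ 0 → ∃ a, w x < w (x - i a)) : Function.Surjective i := by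
  classical
  intro x
  by_contra! hx
  let I : Set ℝ := {g | ∃ a, (g : WithTop ℝ) < w (x - i a)}
  let A : ℝ → LambdaMax k := fun g => if h : g ∈ I then h.choose else 0
  have hA : ∀ g ∈ I, (g : WithTop ℝ) < w (x - i (A g)) := by
    intro g hg
    simp only [A, dif_pos hg]
    exact hg.choose_spec
  have hclose : ∀ {g : ℝ} {a b : LambdaMax k}, (g : WithTop ℝ) < w (x - i a) →
      (g : WithTop ℝ) < w (x - i b) → (g : WithTop ℝ) < valMax k (a - b) := by
    intro g a b ha hb
    rw [← hi, map_sub, ← sub_sub_sub_cancel_left (i b) (i a) x]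
    exact (lt_min hb ha).trans_le (w.map_sub _ _)
  have hI : ∀ g ∈ I, ∀ g' ≤ g, g' ∈ I := fun g hg g' hle =>
    ⟨A g, (WithTop.coe_le_coe.2 hle).trans_lt (hA g hg)⟩
  obtain ⟨y, hy⟩ := exists_glue I A hI fun g hg g' hle => by
    have := lt_valMax_iff.1 (hclose (hA g' (hI g hg g' hle))
      ((WithTop.coe_le_coe.2 hle).trans_lt (hA g hg))) g' le_rfl
    rwa [coeff_sub, sub_eq_zero] at this
  have hxy : ∀ g ∈ I, (g : WithTop ℝ) < w (x - i y) := by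
    intro g hg
    have h1 : (g : WithTop ℝ) < valMax k (A g - y) := lt_valMax_iff.2 fun g' hle => by
      rw [coeff_sub, hy g hg g' hle, sub_self]
    rw [← hi, map_sub] at h1
    rw [← sub_add_sub_cancel x (i (A g)) (i y)]
    exact (lt_min (hA g hg) h1).trans_le (w.map_add _ _)
  have hne : x - i y ≠ 0 := sub_ne_zero.2 fun h => hx y h.symm
  -- The error of `y` exceeds every accuracy in `I`. Improving on `y` would put the value `δ` of
  -- that error into `I`, whence `δ < δ`.
  obtain ⟨δ, hδ⟩ := exists_val_eq_coe w hne
  obtain ⟨a, ha⟩ := himm _ hne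
  rw [sub_sub, ← map_add, hδ] at ha
  exact (hxy δ ⟨_, ha⟩).ne hδ.symm

/-- Krull maximality of `Λ^max`. -/
theorem surjective_of_bijective_coeffToResidue {K : Type*} [Field K]
    (w : AddValuation K (WithTop ℝ)) (i : LambdaMax k →+* K)
    (hi : IsValuedExtension (valMax k) w i)
    (hbij : Function.Bijective (coeffToResidue w i hi)) : Function.Surjective i := by
  refine surjective_of_immediate w i hi fun x hx => ?_
  obtain ⟨r, hr⟩ := exists_val_eq_coe w hx
  -- Multiplying by `T ^ (-r)` brings `x` to value `0`. Its residue class is that of a constant `c`,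
  -- and `c * T ^ r` is the leading term of `x`.
  have hT : w (i (single (-r) 1)) = ((-r : ℝ) : WithTop ℝ) := by
    rw [hi, valMax_single one_ne_zero]
  have hu : w (x * i (single (-r) 1)) = 0 := by
    rw [w.map_mul, hr, hT, ← WithTop.coe_add, add_neg_cancel, WithTop.coe_zero]
  obtain ⟨c, hc⟩ := hbij.2 (IsLocalRing.residue (integerRing w)
    ⟨x * i (single (-r) 1), (mem_integerRing _ _).2 hu.ge⟩)
  have hlt : 0 < w (x * i (single (-r) 1) - i (C c)) := by
    have h1 := sub_eq_zero.2 hc.symm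
    rw [coeffToResidue, RingHom.comp_apply, ← map_sub, IsLocalRing.residue_eq_zero_iff] at h1
    exact val_pos_of_mem_maximalIdeal w h1
  refine ⟨C c * single r 1, ?_⟩
  have hxe : x - i (C c * single r 1) =
      (x * i (single (-r) 1) - i (C c)) * i (single r 1) := by
    have h1 : (single (-r) 1 * single r 1 : LambdaMax k) = 1 := by
      rw [single_mul_single, neg_add_cancel, one_mul]
      rfl
    rw [sub_mul, mul_assoc, ← map_mul, ← map_mul, h1, RingHom.map_one i, mul_one]
  rw [hxe, w.map_mul, hi, valMax_single one_ne_zero, hr]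
  calc (r : WithTop ℝ) = 0 + r := (zero_add _).symm
    _ < _ := WithTop.add_lt_add_right WithTop.coe_ne_top hlt

end Glue


/-! ### Extension of valuations to algebraic extensions -/

section Extension

/-- The valuation attached to a nonarchimedean absolute value. -/
theorem exists_absVal_eq {L : Type*} [Field L] (f : AbsoluteValue L ℝ)
    (hf : ∀ x y, f (x + y) ≤ max (f x) (f y)) :
    ∃ w : AddValuation L (WithTop ℝ), ∀ x, absVal w x = f x := by
  classical
  let g : L → WithTop ℝ := fun x => if x = 0 then ⊤ else ((-Real.log (f x) : ℝ) : WithTop ℝ)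
  have hg : ∀ {x}, x ≠ 0 → g x = ((-Real.log (f x) : ℝ) : WithTop ℝ) := fun hx => if_neg hx
  have hg0 : g 0 = ⊤ := if_pos rfl
  have hle : ∀ {x y}, f x ≤ f y → g y ≤ g x := by
    intro x y h
    by_cases hx : x = 0
    · rw [hx, hg0]
      exact le_top
    have hy : y ≠ 0 := by
      rintro rfl
      rw [f.map_zero] at h
      exact (f.pos hx).not_ge h
    rw [hg hx, hg hy, WithTop.coe_le_coe, neg_le_neg_iff]
    exact Real.log_le_log (f.pos hx) h
  let w : AddValuation L (WithTop ℝ) := AddValuation.of g hg0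
    (by rw [hg one_ne_zero, f.map_one, Real.log_one, neg_zero, WithTop.coe_zero])
    (fun x y => by
      rcases le_max_iff.1 (hf x y) with h | h
      · exact min_le_of_left_le (hle h)
      · exact min_le_of_right_le (hle h))
    (fun x y => by
      by_cases hx : x = 0
      · rw [hx, zero_mul, hg0, WithTop.top_add]
      by_cases hy : y = 0
      · rw [hy, mul_zero, hg0, WithTop.add_top]
      rw [hg hx, hg hy, hg (mul_ne_zero hx hy), f.map_mul,
        Real.log_mul (f.pos hx).ne' (f.pos hy).ne', neg_add, WithTop.coe_add])
  refine ⟨w, fun x => ?_⟩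
  by_cases hx : x = 0
  · rw [hx, absVal_zero, f.map_zero]
  · have hwx : w x = ((-Real.log (f x) : ℝ) : WithTop ℝ) := hg hx
    rw [absVal_of_val_eq w hwx, neg_neg, Real.exp_log (f.pos hx)]

theorem absVal_eq_absVal {K L : Type*} [Field K] [Field L] {v : AddValuation K (WithTop ℝ)}
    {w : AddValuation L (WithTop ℝ)} {a : K} {b : L} : absVal v a = absVal w b ↔ v a = w b := by
  rw [le_antisymm_iff, absVal_le_absVal, absVal_le_absVal, and_comm, le_antisymm_iff]

variable {F L : Type*} [Field F] [Field L] [Algebra F L] [Algebra.IsAlgebraic F L]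

/-- A complete nontrivial valuation extends uniquely to an algebraic extension, and the
coefficients of minimal polynomials are bounded by powers of the generator. -/
theorem exists_unique_extension (v : AddValuation F (WithTop ℝ)) (hc : IsCompleteValued v)
    (hv : ∃ a : F, a ≠ 0 ∧ v a ≠ 0) :
    ∃ w : AddValuation L (WithTop ℝ), IsValuedExtension v w (algebraMap F L) ∧
      (∀ w' : AddValuation L (WithTop ℝ), IsValuedExtension v w' (algebraMap F L) → w' = w) ∧
      ∀ (x : L) (m : ℕ), m < (minpoly F x).natDegree →
        w (x ^ ((minpoly F x).natDegree - m)) ≤ v ((minpoly F x).coeff m) := by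
  let : NormedField F := (absoluteValue v).toNormedField
  have hnorm : ∀ a : F, ‖a‖ = absVal v a := fun _ => rfl
  let : NontriviallyNormedField F := NontriviallyNormedField.ofNormNeOne (by
    obtain ⟨a, ha, hva⟩ := hv
    refine ⟨a, ha, fun h => hva ?_⟩
    obtain ⟨r, hr⟩ := exists_val_eq_coe v ha
    rw [hnorm, absVal_of_val_eq v hr, Real.exp_eq_one_iff, neg_eq_zero] at h
    rw [hr, h, WithTop.coe_zero])
  have hultra : IsUltrametricDist F :=
    IsUltrametricDist.isUltrametricDist_of_isNonarchimedean_norm (absVal_add_le_max v)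
  have hcomplete : CompleteSpace F := by
    refine Metric.complete_of_cauchySeq_tendsto fun u hu => ?_
    obtain ⟨a, ha⟩ := hc u fun ε hε => by
      obtain ⟨N, hN⟩ := Metric.cauchySeq_iff.1 hu ε hε
      exact ⟨N, fun m n hm hn => (dist_eq_norm (u m) (u n) ▸ hN m hm n hn :)⟩
    refine ⟨a, Metric.tendsto_atTop.2 fun ε hε => ?_⟩
    obtain ⟨N, hN⟩ := ha ε hε
    exact ⟨N, fun n hn => (dist_eq_norm (u n) a).trans_lt (hN n hn)⟩
  let f : AbsoluteValue L ℝ :=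
    MulRingNorm.mulRingNormEquivAbsoluteValue (spectralMulAlgNorm F L).toMulRingNorm
  have hf : ∀ x, f x = spectralNorm F L x := fun _ => rfl
  obtain ⟨w, hw⟩ := exists_absVal_eq f fun x y => by
    rw [hf, hf, hf]
    exact isNonarchimedean_spectralNorm x y
  refine ⟨w, fun a => ?_, fun w' hw' => ?_, fun x m hm => ?_⟩
  · rw [← absVal_eq_absVal, hw, hf, spectralNorm_extends, hnorm]
  · ext x
    rw [← absVal_eq_absVal, hw, hf, ← absoluteValue_apply]
    refine spectralNorm_unique_field_norm_ext (fun a => ?_) x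
    rw [absoluteValue_apply, hnorm, absVal_eq_absVal]
    exact hw' a
  · rw [← absVal_le_absVal, hw, f.map_pow, hf, ← hnorm]
    -- The spectral norm is the supremum of the numbers `‖a_m‖ ^ (1 / (n - m))`, with `a_m` the
    -- coefficients and `n` the degree of the minimal polynomial; one of these terms, raised to the
    -- power `n - m`, gives the bound.
    have h1 : spectralValueTerms (minpoly F x) m ≤ spectralNorm F L x :=
      le_ciSup (spectralValueTerms_bddAbove (minpoly F x)) m
    have hpos : 0 < (minpoly F x).natDegree - m := Nat.sub_pos_of_lt hm
    rw [spectralValueTerms_of_lt_natDegree _ hm, ← Nat.cast_sub hm.le, one_div] at h1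
    calc ‖(minpoly F x).coeff m‖
        = (‖(minpoly F x).coeff m‖ ^ (((((minpoly F x).natDegree - m : ℕ) : ℝ))⁻¹)) ^
          ((minpoly F x).natDegree - m) :=
          (Real.rpow_inv_natCast_pow (norm_nonneg _) hpos.ne').symm
      _ ≤ _ := pow_le_pow_left₀ (Real.rpow_nonneg (norm_nonneg _) _) h1 _

end Extension


/-! ### Algebraically closed residue field -/

section AlgClosed

open Polynomial in
-- The coefficient is a Taylor coefficient at `b`: the Hasse derivative of order `n - 1` of a monic
-- polynomial of degree `n` is linear with leading coefficient `n`.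
theorem coeff_comp_X_add_C_pred {F : Type*} [Field F] {p : F[X]} (h : p.Monic)
    (hn : 0 < p.natDegree) (b : F) :
    (p.comp (X + Polynomial.C b)).coeff (p.natDegree - 1) =
      p.coeff (p.natDegree - 1) + p.natDegree * b := by
  obtain ⟨m, hm⟩ : ∃ m, p.natDegree = m + 1 := ⟨_, (Nat.sub_add_cancel hn).symm⟩
  have h1 : p.coeff (m + 1) = 1 := hm ▸ h
  have hdeg : (hasseDeriv m p).natDegree < 2 := by
    have := natDegree_hasseDeriv_le p m
    omega
  rw [hm, Nat.add_sub_cancel, ← taylor_apply, taylor_coeff, eval_eq_sum_range' hdeg,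
    Finset.sum_range_succ, Finset.sum_range_one, hasseDeriv_coeff, hasseDeriv_coeff,
    add_comm 1 m, h1, Nat.choose_succ_self_right]
  simp

variable {k F L : Type*} [Field k] [Field F] [Field L] [Algebra F L] [Algebra.IsAlgebraic F L]

open Polynomial in
/-- Let `k` be algebraically closed and let `w` extend `v`, where the residue field of `v` is
represented by `κ` and `v` has value group `ℝ`. Then `w` is an immediate extension. -/
theorem exists_val_lt_val_sub [IsAlgClosed k] {v : AddValuation F (WithTop ℝ)} (κ : k →+* F)
    (hres : ∀ a, 0 ≤ v a → ∃ c, 0 < v (a - κ c)) (hval : ∀ r : ℝ, ∃ a, v a = r)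
    {w : AddValuation L (WithTop ℝ)} (hw : IsValuedExtension v w (algebraMap F L))
    (hcoeff : ∀ (x : L) (m : ℕ), m < (minpoly F x).natDegree →
      w (x ^ ((minpoly F x).natDegree - m)) ≤ v ((minpoly F x).coeff m))
    {x : L} (hx : x ≠ 0) : ∃ a : F, w x < w (x - algebraMap F L a) := by
  obtain ⟨r, hr⟩ := exists_val_eq_coe w hx
  obtain ⟨t, ht⟩ := hval (-r)
  have ht0 : t ≠ 0 := by
    rintro rfl
    rw [v.map_zero] at ht
    exact WithTop.top_ne_coe ht
  set u : L := x * algebraMap F L t with hu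
  have hwu : w u = 0 := by
    rw [hu, w.map_mul, hr, hw, ht, ← WithTop.coe_add, add_neg_cancel, WithTop.coe_zero]
  suffices ∃ c : k, 0 < w (u - algebraMap F L (κ c)) by
    obtain ⟨c, hc⟩ := this
    refine ⟨κ c * t⁻¹, ?_⟩
    have hte : algebraMap F L t ≠ 0 := by simpa using ht0
    have hxe : u - algebraMap F L (κ c) =
        (x - algebraMap F L (κ c * t⁻¹)) * algebraMap F L t := by
      rw [hu, sub_mul, ← map_mul, inv_mul_cancel_right₀ ht0]
    rw [hxe, w.map_mul, hw, ht] at hc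
    rw [hr]
    by_contra! hle
    have h1 := add_le_add_left hle ((-r : ℝ) : WithTop ℝ)
    rw [← WithTop.coe_add, add_neg_cancel, WithTop.coe_zero] at h1
    exact hc.not_ge h1
  set p := minpoly F u with hp
  have hint : IsIntegral F u := Algebra.IsIntegral.isIntegral u
  have hex : ∀ m : Fin p.natDegree, ∃ c, 0 < v (p.coeff m - κ c) := fun m => hres _ (by
    refine le_trans ?_ (hcoeff u m m.2)
    rw [w.map_pow, hwu, nsmul_zero])
  choose c hc using hex
  -- Since `w u = 0`, `hcoeff` makes the minimal polynomial of `u` integral; `q` is its reduction to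
  -- `k`.
  set q : k[X] := X ^ p.natDegree + ∑ i : Fin p.natDegree, Polynomial.C (c i) * X ^ (i : ℕ) with hq
  have hqm : q.Monic := monic_X_pow_add (degree_sum_fin_lt c)
  set κ' : k →+* L := (algebraMap F L).comp κ with hκ'
  have hpu : u ^ p.natDegree +
      ∑ i : Fin p.natDegree, algebraMap F L (p.coeff i) * u ^ (i : ℕ) = 0 := by
    have h := minpoly.aeval F u
    have hlead : p.coeff p.natDegree = 1 := minpoly.monic hint
    rw [aeval_eq_sum_range, Finset.sum_range_succ, ← hp, hlead, one_smul, Finset.sum_range, add_comm] at h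
    simpa only [Algebra.smul_def] using h
  have hqu : 0 < w (q.eval₂ κ' u) := by
    have h1 : q.eval₂ κ' u =
        ∑ i : Fin p.natDegree, -(algebraMap F L (p.coeff i - κ (c i)) * u ^ (i : ℕ)) := by
      rw [← sub_zero (q.eval₂ κ' u), ← hpu, hq]
      simp only [eval₂_add, eval₂_finsetSum, eval₂_mul, eval₂_pow, eval₂_X, eval₂_C, hκ',
        RingHom.comp_apply, map_sub, sub_mul, neg_sub, Finset.sum_sub_distrib]
      ring
    rw [h1]
    refine w.map_lt_sum WithTop.zero_ne_top fun i _ => ?_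
    rw [w.map_neg, w.map_mul, hw, w.map_pow, hwu, nsmul_zero, add_zero]
    exact hc i
  by_contra! hle
  -- `q` is a product of factors `X - s` with `s` in `k`. If no `u - s` had positive value, neither
  -- would `q(u)`.
  rw [(IsAlgClosed.splits q).eq_prod_roots_of_monic hqm, eval₂_multiset_prod] at hqu
  refine hqu.not_ge (Multiset.prod_induction (fun y => w y ≤ 0) _ (fun a b ha hb => ?_) ?_ ?_)
  · rw [w.map_mul]
    exact add_nonpos ha hb
  · rw [w.map_one]
  · intro y hy
    simp only [Multiset.map_map, Multiset.mem_map, Function.comp_apply] at hy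
    obtain ⟨s, -, rfl⟩ := hy
    rw [eval₂_sub, eval₂_X, eval₂_C]
    exact hle s

/-- In residue characteristic zero, an immediate algebraic extension of a complete field is
trivial. -/
theorem algebraMap_surjective_of_immediate [CharZero k] {v : AddValuation F (WithTop ℝ)}
    (κ : k →+* F) (hκ : ∀ c, c ≠ 0 → v (κ c) = 0)
    {w : AddValuation L (WithTop ℝ)} (hw : IsValuedExtension v w (algebraMap F L))
    (hcoeff : ∀ (x : L) (m : ℕ), m < (minpoly F x).natDegree →
      w (x ^ ((minpoly F x).natDegree - m)) ≤ v ((minpoly F x).coeff m))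
    (himm : ∀ x : L, x ≠ 0 → ∃ a : F, w x < w (x - algebraMap F L a)) :
    Function.Surjective (algebraMap F L) := by
  intro x
  set n := (minpoly F x).natDegree with hn
  have hn0 : 0 < n := minpoly.natDegree_pos (Algebra.IsIntegral.isIntegral x)
  have hvn : v (n : F) = 0 := by
    rw [← map_natCast κ]
    exact hκ _ (Nat.cast_ne_zero.2 hn0.ne')
  have hnF : (n : F) ≠ 0 := by
    intro h
    rw [h, v.map_zero] at hvn
    exact WithTop.top_ne_zero hvn
  -- The mean of the conjugates of `x`: the minimal polynomial of `x - s` has no term of degree `n -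
  -- 1`, so that of `x - s - a` has `n * a` there.
  set s : F := -(minpoly F x).coeff (n - 1) / n with hs
  by_contra! hne
  obtain ⟨a, ha⟩ := himm (x - algebraMap F L s) (sub_ne_zero.2 fun h => hne s h.symm)
  rw [sub_sub, ← map_add] at ha
  have hmin := minpoly.sub_algebraMap x (s + a)
  have hdeg : (minpoly F (x - algebraMap F L (s + a))).natDegree = n := by
    rw [hmin, Polynomial.natDegree_comp, Polynomial.natDegree_X_add_C, mul_one]
  have hcf : (minpoly F (x - algebraMap F L (s + a))).coeff (n - 1) = n * a := by
    rw [hmin, hn, coeff_comp_X_add_C_pred (minpoly.monic (Algebra.IsIntegral.isIntegral x)) hn0,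
      ← hn, hs, mul_add, mul_div_cancel₀ _ hnF]
    ring
  -- As `n` has value `0`, this gives `w (x - s - a) ≤ v a`. But `a` approximates `x - s`, so `v a =
  -- w (x - s) < w (x - s - a)`.
  have h1 := hcoeff (x - algebraMap F L (s + a)) (n - 1) (by omega)
  rw [hdeg, hcf, Nat.sub_sub_self hn0, pow_one, v.map_mul, hvn, zero_add] at h1
  have h2 : w (algebraMap F L a) = w (x - algebraMap F L s) := by
    have : algebraMap F L a =
        (x - algebraMap F L s) + -(x - algebraMap F L (s + a)) := by
      rw [map_add]
      ring
    rw [this]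
    exact w.map_add_eq_of_lt_left (by rwa [w.map_neg])
  rw [hw] at h2
  exact (ha.trans_le h1).ne h2.symm

end AlgClosed

/-! ### Algebraic closedness of `Λ^max` and `Λ^min` -/

section Closed

variable {k : Type*} [Field k]

/-- Constants, as elements of `Λ^min`. -/
def constMin : k →+* LambdaMin k :=
  (HahnSeries.C : k →+* LambdaMax k).codRestrict (LambdaMin k) fun c => HalfFinite.single 0 c

/-- Monomials, as elements of `Λ^min`. -/
def singleMin (g : ℝ) (c : k) : LambdaMin k := ⟨single g c, HalfFinite.single g c⟩

theorem valMin_singleMin {g : ℝ} {c : k} (hc : c ≠ 0) : valMin k (singleMin g c) = g :=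
  valMax_single hc

theorem valMax_sub_C_pos {a : LambdaMax k} (ha : 0 ≤ valMax k a) :
    0 < valMax k (a - C (a.coeff 0)) := by
  rw [← WithTop.coe_zero]
  refine lt_valMax_iff.2 fun g hg => ?_
  rcases hg.eq_or_lt with rfl | hlt
  · rw [coeff_sub, C_apply, coeff_single_same, sub_self]
  · rw [coeff_sub, C_apply, coeff_single_of_ne hlt.ne, sub_zero]
    refine coeff_eq_zero_of_lt_orderTop ?_
    rw [addVal_apply] at ha
    exact (WithTop.coe_lt_coe.2 hlt).trans_le ha

theorem isAlgClosed_of_algebraMap_surjective {F : Type*} [Field F]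
    (h : Function.Surjective (algebraMap F (AlgebraicClosure F))) : IsAlgClosed F :=
  IsAlgClosed.of_ringEquiv (AlgebraicClosure F) F
    (RingEquiv.ofBijective _ ⟨(algebraMap F (AlgebraicClosure F)).injective, h⟩).symm

theorem exists_valMin_ne_zero : ∃ a : LambdaMin k, a ≠ 0 ∧ valMin k a ≠ 0 := by
  have h : valMin k (singleMin 1 1) = ((1 : ℝ) : WithTop ℝ) := valMin_singleMin one_ne_zero
  refine ⟨singleMin 1 1, ?_, ?_⟩
  · intro h0
    rw [h0, (valMin k).map_zero] at h
    exact WithTop.top_ne_coe h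
  · rw [h]
    exact fun h1 => one_ne_zero (WithTop.coe_injective h1)

theorem exists_valMax_ne_zero : ∃ a : LambdaMax k, a ≠ 0 ∧ valMax k a ≠ 0 := by
  refine ⟨single 1 1, single_ne_zero one_ne_zero, ?_⟩
  rw [valMax_single one_ne_zero]
  exact fun h1 => one_ne_zero (WithTop.coe_injective h1)

theorem isAlgClosed_lambdaMax [IsAlgClosed k] : IsAlgClosed (LambdaMax k) := by
  obtain ⟨w, hw, -, hcoeff⟩ := exists_unique_extension (L := AlgebraicClosure (LambdaMax k))
    (valMax k) isCompleteValued_valMax exists_valMax_ne_zero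
  refine isAlgClosed_of_algebraMap_surjective ?_
  refine surjective_of_immediate w _ hw fun x hx => ?_
  exact exists_val_lt_val_sub (v := valMax k) (w := w) C
    (fun a ha => ⟨a.coeff 0, valMax_sub_C_pos ha⟩)
      (fun r => ⟨single r 1, valMax_single one_ne_zero⟩) hw hcoeff hx

theorem isAlgClosed_lambdaMin [CharZero k] [IsAlgClosed k] : IsAlgClosed (LambdaMin k) := by
  obtain ⟨w, hw, -, hcoeff⟩ := exists_unique_extension (L := AlgebraicClosure (LambdaMin k))
    (valMin k) isCompleteValued_valMin exists_valMin_ne_zero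
  refine isAlgClosed_of_algebraMap_surjective <|
    algebraMap_surjective_of_immediate constMin (fun c hc => ?_) hw hcoeff fun x hx =>
      exists_val_lt_val_sub constMin (fun a ha => ⟨(a : LambdaMax k).coeff 0, valMax_sub_C_pos (a := (a : LambdaMax k)) ha⟩)
        (fun r => ⟨singleMin r 1, valMin_singleMin one_ne_zero⟩) hw hcoeff hx
  exact valMin_singleMin hc

end Closed


/-! ### Artin-Schreier extensions in positive characteristic -/

section ArtinSchreier

theorem exists_pow_sub_self_eq {E : Type*} [Field E] [IsAlgClosed E] {p : ℕ} (hp : 1 < p) (c : E) :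
    ∃ y : E, y ^ p - y = c := by
  have hdeg : (Polynomial.X ^ p - (Polynomial.X + Polynomial.C c)).degree = (p : WithBot ℕ) := by
    rw [Polynomial.degree_sub_eq_left_of_degree_lt] <;>
      rw [Polynomial.degree_X_pow]
    rw [Polynomial.degree_X_add_C]
    exact_mod_cast hp
  obtain ⟨y, hy⟩ := IsAlgClosed.exists_root
    (Polynomial.X ^ p - (Polynomial.X + Polynomial.C c)) (by
      rw [hdeg]
      exact_mod_cast (zero_lt_one.trans hp).ne')
  refine ⟨y, ?_⟩
  rw [Polynomial.IsRoot, Polynomial.eval_sub, Polynomial.eval_pow, Polynomial.eval_add,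
    Polynomial.eval_X, Polynomial.eval_C] at hy
  linear_combination hy

/-- Artin-Schreier generators are linearly independent if the corresponding right-hand sides are
independent modulo `y ^ p - y`. -/
theorem linearIndependent_artinSchreier {F L ι : Type*} [Field F] [Field L] [Algebra F L]
    (p : ℕ) [Fact p.Prime] [CharP F p] [CharP L p] {c : ι → F} {α : ι → L}
    (hα : ∀ i, α i ^ p - α i = algebraMap F L (c i))
    (hc : ∀ (s : Finset ι) (g : ι → F), (∀ i ∈ s, g i ^ p = g i) →
      ∀ y : F, y ^ p - y = ∑ i ∈ s, g i * c i → ∀ i ∈ s, g i = 0) :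
    LinearIndependent F α := by
  classical
  -- Allowing an arbitrary `f₀` in `F` on the right is what lets the induction on `s` go through.
  have key : ∀ (s : Finset ι) (f : ι → F) (f₀ : F),
      ∑ i ∈ s, algebraMap F L (f i) * α i = algebraMap F L f₀ → ∀ i ∈ s, f i = 0 := by
    intro s
    induction s using Finset.strongInduction with
    | H s ih =>
      intro f f₀ hf i₀ hi₀
      by_contra hne
      set g : ι → F := fun i => f i / f i₀ with hg
      set g₀ : F := f₀ / f i₀ with hg₀
      have hgi₀ : g i₀ = 1 := div_self hne
      have hgs : ∑ i ∈ s, algebraMap F L (g i) * α i = algebraMap F L g₀ := by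
        rw [hg₀, map_div₀, ← hf, Finset.sum_div]
        refine Finset.sum_congr rfl fun i _ => ?_
        rw [hg, map_div₀, div_mul_eq_mul_div]
      -- The `p`-th power of the normalised relation minus the relation itself. The coefficient at
      -- `i₀` cancels because `g i₀ = 1`, so the relation is shorter and induction gives `g i ^ p =
      -- g i`.
      have hpow : ∑ i ∈ s, algebraMap F L (g i ^ p - g i) * α i =
          algebraMap F L (g₀ ^ p - g₀ - ∑ i ∈ s, g i ^ p * c i) := by
        have h1 : ∑ i ∈ s, algebraMap F L (g i) ^ p * α i ^ p = algebraMap F L g₀ ^ p := by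
          rw [← hgs, sum_pow_char]
          exact Finset.sum_congr rfl fun i _ => (mul_pow _ _ _).symm
        have h2 : ∑ i ∈ s, algebraMap F L (g i) ^ p * α i ^ p =
            ∑ i ∈ s, algebraMap F L (g i) ^ p * α i +
              ∑ i ∈ s, algebraMap F L (g i) ^ p * algebraMap F L (c i) := by
          rw [← Finset.sum_add_distrib]
          refine Finset.sum_congr rfl fun i _ => ?_
          rw [← mul_add, ← hα i, add_sub_cancel]
        simp only [map_sub, map_sum, map_mul, map_pow, sub_mul, Finset.sum_sub_distrib]
        rw [hgs, ← h1, h2]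
        ring
      have hzero : ∀ i ∈ s, g i ^ p = g i := by
        intro i hi
        by_cases hii : i = i₀
        · rw [hii, hgi₀, one_pow]
        · have h3 := ih (s.erase i₀) (Finset.erase_ssubset hi₀) (fun i => g i ^ p - g i)
            (g₀ ^ p - g₀ - ∑ i ∈ s, g i ^ p * c i) (by
              rw [← hpow, Finset.sum_erase]
              rw [hgi₀, one_pow, sub_self, map_zero, zero_mul])
          exact sub_eq_zero.1 (h3 i (Finset.mem_erase.2 ⟨hii, hi⟩))
      have h0 : g₀ ^ p - g₀ = ∑ i ∈ s, g i * c i := by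
        rw [Finset.sum_eq_zero fun i hi => by rw [hzero i hi, sub_self, map_zero, zero_mul]]
          at hpow
        have := (algebraMap F L).injective (hpow.symm.trans (map_zero _).symm)
        rw [sub_eq_zero.1 this]
        exact Finset.sum_congr rfl fun i hi => by rw [hzero i hi]
      exact one_ne_zero (hgi₀.symm.trans (hc s g hzero g₀ h0 i₀ hi₀))
  rw [linearIndependent_iff']
  intro s f hf
  refine key s f 0 ?_
  rw [map_zero, ← hf]
  exact Finset.sum_congr rfl fun i _ => (Algebra.smul_def _ _).symm

variable {k : Type*} [Field k]

/-- Exponents in the interval `(1, 2)`. -/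
def asExp (n : ℕ) : ℝ := 1 + 1 / (n + 2)

theorem one_lt_asExp (n : ℕ) : 1 < asExp n := by
  have : (0 : ℝ) < 1 / (n + 2) := by positivity
  unfold asExp
  linarith

theorem asExp_lt_two (n : ℕ) : asExp n < 2 := by
  have : (1 : ℝ) / (n + 2) < 1 := by
    rw [div_lt_one (by positivity)]
    have : (0 : ℝ) ≤ n := Nat.cast_nonneg n
    linarith
  unfold asExp
  linarith

theorem asExp_injective : Function.Injective asExp := by
  intro m n h
  unfold asExp at h
  have h1 := add_left_cancel h
  rw [one_div, one_div, inv_inj] at h1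
  exact_mod_cast add_right_cancel h1

/-- All exponents lie between `1` and `2`, so none is another one multiplied by a positive power of
`p`. The chains through the various `-asExp i` therefore do not interfere, and
`HalfFinite.coeff_pow_char_sub_self` treats each one separately. -/
theorem eq_zero_of_pow_char_sub_self_eq (p : ℕ) [Fact p.Prime] [CharP k p] {y : LambdaMax k}
    (hy : HalfFinite y) {s : Finset ℕ} {m : ℕ → k}
    (h : y ^ p - y = ∑ i ∈ s, single (-asExp i) (m i)) : ∀ i ∈ s, m i = 0 := by
  classical
  have hp2 : (2 : ℝ) ≤ p := by exact_mod_cast (Fact.out : p.Prime).two_le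
  have hpow : ∀ j : ℕ, (2 : ℝ) ≤ (p : ℝ) ^ (j + 1) := fun j =>
    hp2.trans (le_self_pow₀ (by linarith) (Nat.succ_ne_zero j))
  have hcoeff : ∀ g, (∀ i ∈ s, g ≠ -asExp i) → (y ^ p - y).coeff g = 0 := by
    intro g hg
    rw [h, coeff_sum]
    exact Finset.sum_eq_zero fun i hi => coeff_single_of_ne (hg i hi)
  intro i hi
  have hm : (y ^ p - y).coeff (-asExp i) = m i := by
    rw [h, coeff_sum, Finset.sum_eq_single i, coeff_single_same]
    · intro j _ hj
      exact coeff_single_of_ne fun h1 => hj (asExp_injective (neg_injective h1)).symm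
    · exact fun h1 => absurd hi h1
  rw [← hm]
  refine hy.coeff_pow_char_sub_self p (zero_lt_one.trans (one_lt_asExp i)) (fun j => ?_) fun j => ?_
  · refine hcoeff _ fun i' _ h1 => ?_
    have h2 := hpow j
    rw [div_eq_iff (by linarith)] at h1
    nlinarith [one_lt_asExp i', asExp_lt_two i]
  · refine hcoeff _ fun i' _ h1 => ?_
    have h2 := hpow j
    nlinarith [one_lt_asExp i, asExp_lt_two i']

instance charP_lambdaMin (p : ℕ) [CharP k p] : CharP (LambdaMin k) p :=
  charP_of_injective_ringHom (constMin (k := k)).injective p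

theorem not_isAlgClosed_lambdaMin (p : ℕ) [Fact p.Prime] [CharP k p] :
    ¬ IsAlgClosed (LambdaMin k) := by
  intro hK
  obtain ⟨y, hy⟩ := exists_pow_sub_self_eq (Fact.out : p.Prime).one_lt
    (singleMin (-asExp 0) 1 : LambdaMin k)
  refine one_ne_zero (α := k) (eq_zero_of_pow_char_sub_self_eq p y.2 (s := {0})
    (m := fun _ => 1) ?_ 0 (Finset.mem_singleton_self 0))
  rw [Finset.sum_singleton]
  exact congrArg Subtype.val hy

theorem linearIndependent_of_pow_sub_self_eq {L : Type*} [Field L] [Algebra (LambdaMin k) L]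
    (p : ℕ) [Fact p.Prime] [CharP k p] [CharP L p] {α : ℕ → L}
    (hα : ∀ i, α i ^ p - α i = algebraMap (LambdaMin k) L (singleMin (-asExp i) 1)) :
    LinearIndependent (LambdaMin k) α := by
  refine linearIndependent_artinSchreier p hα fun s g hg y hy => ?_
  -- Solutions of `g ^ p = g` lie in the prime field, so they are constants.
  have hconst : ∀ i ∈ s, ∃ m : k, constMin m = g i := by
    intro i hi
    have h1 : g i ∈ (⊥ : Subfield (LambdaMin k)) :=
      (Subfield.mem_bot_iff_pow_eq_self _ p).2 (hg i hi)
    exact (bot_le : (⊥ : Subfield (LambdaMin k)) ≤ (constMin (k := k)).fieldRange) h1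
  choose! m hm using hconst
  have h0 := eq_zero_of_pow_char_sub_self_eq p y.2 (s := s) (m := m) (by
    have h1 := congrArg (LambdaMin k).subtype hy
    rw [map_sum] at h1
    refine h1.trans (Finset.sum_congr rfl fun i hi => ?_)
    rw [← hm i hi]
    change C (m i) * single (-asExp i) 1 = _
    rw [C_apply, single_mul_single, zero_add, mul_one])
  intro i hi
  rw [← hm i hi, h0 i hi, map_zero]

end ArtinSchreier


/-! ### Incompleteness of the algebraic closure of `Λ^min` in characteristic `p` -/

section Incomplete

open Polynomial in
-- The minimal polynomial has degree at least two and distinct roots, all in `L`; by normality some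
-- automorphism carries `α` to another root.
theorem exists_algEquiv_apply_ne {E L : Type*} [Field E] [Field L] [Algebra E L] [Normal E L]
    {α : L} (hsep : (minpoly E α).Separable) (hα : α ∉ (algebraMap E L).range) :
    ∃ σ : L ≃ₐ[E] L, σ α ≠ α := by
  have hint : IsIntegral E α := Normal.isIntegral inferInstance α
  have hcard := card_rootSet_eq_natDegree hsep (Normal.splits (inferInstance : Normal E L) α)
  have hdeg : 1 < Fintype.card ((minpoly E α).rootSet L) := by
    rw [hcard]
    refine lt_of_le_of_ne (minpoly.natDegree_pos hint) fun h => hα ?_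
    exact minpoly.natDegree_eq_one_iff.1 h.symm
  have hmem : α ∈ (minpoly E α).rootSet L :=
    mem_rootSet.2 ⟨minpoly.ne_zero hint, minpoly.aeval E α⟩
  obtain ⟨⟨y, hy⟩, hne⟩ := Fintype.exists_ne_of_one_lt_card hdeg ⟨α, hmem⟩
  obtain ⟨σ, hσ⟩ := minpoly.exists_algEquiv_of_root hint.isAlgebraic (mem_rootSet.1 hy).2
  refine ⟨σ, fun h => hne (Subtype.ext ?_)⟩
  exact σ.injective (hσ.trans h.symm)

open Polynomial in
theorem separable_minpoly_of_pow_sub_self_eq {E L : Type*} [Field E] [Field L] [Algebra E L]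
    (p : ℕ) [CharP E p] {α : L} {c : E} (h : α ^ p - α = algebraMap E L c) :
    (minpoly E α).Separable := by
  have hs : (X ^ p - X - Polynomial.C c : E[X]).Separable := by
    rw [Separable, derivative_sub, derivative_sub, derivative_X_pow, derivative_X, derivative_C,
      CharP.cast_eq_zero, map_zero, zero_mul, zero_sub, sub_zero]
    exact isCoprime_one_right.neg_right
  refine hs.of_dvd (minpoly.dvd E α ?_)
  rw [map_sub, map_sub, map_pow, aeval_X, aeval_C, h, sub_self]

variable {k : Type*} [Field k] {L : Type*} [Field L] [Algebra (LambdaMin k) L]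

/-- If `ν α < -2`, then `α ^ p = α + T ^ (-asExp i)` has value at least `ν α`, which contradicts `p
* ν α < ν α`. The bound is uniform in `i`, so the terms `T ^ m * α m` tend to `0`. -/
theorem neg_two_le_val (p : ℕ) [Fact p.Prime] {ν : AddValuation L (WithTop ℝ)}
    (hν : IsValuedExtension (valMin k) ν (algebraMap (LambdaMin k) L)) {α : L} {i : ℕ}
    (hα : α ^ p - α = algebraMap (LambdaMin k) L (singleMin (-asExp i) 1)) :
    ((-2 : ℝ) : WithTop ℝ) ≤ ν α := by
  by_contra! hlt
  have hp2 : (2 : ℝ) ≤ p := by exact_mod_cast (Fact.out : p.Prime).two_le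
  obtain ⟨r, hr⟩ := WithTop.ne_top_iff_exists.1 hlt.ne_top
  rw [← hr, WithTop.coe_lt_coe] at hlt
  have h1 : (r : WithTop ℝ) ≤ ν (α ^ p) := by
    rw [← sub_add_cancel (α ^ p) α, hα]
    refine le_trans (le_min ?_ hr.le) (ν.map_add _ _)
    rw [hν, valMin_singleMin one_ne_zero, WithTop.coe_le_coe]
    linarith [asExp_lt_two i]
  rw [ν.map_pow, ← hr, ← WithTop.coe_nsmul, WithTop.coe_le_coe, nsmul_eq_mul] at h1
  nlinarith

theorem val_eq_zero_of_pow_eq_self (p : ℕ) [Fact p.Prime] (ν : AddValuation L (WithTop ℝ)) {d : L}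
    (hd : d ^ p = d) (h0 : d ≠ 0) : ν d = 0 := by
  have hp2 : (2 : ℝ) ≤ p := by exact_mod_cast (Fact.out : p.Prime).two_le
  obtain ⟨r, hr⟩ := exists_val_eq_coe ν h0
  have h1 : ν (d ^ p) = ν d := by rw [hd]
  rw [ν.map_pow, hr, ← WithTop.coe_nsmul, WithTop.coe_inj, nsmul_eq_mul] at h1
  have h2 : ((p : ℝ) - 1) * r = 0 := by linear_combination h1
  rcases mul_eq_zero.1 h2 with h3 | h3
  · linarith
  · rw [hr, h3, WithTop.coe_zero]

/-- For `α` generating Artin-Schreier extensions, infinitely many `α n` are moved by some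
automorphism fixing the previous ones. -/
theorem exists_algEquiv_moves_first (p : ℕ) [Fact p.Prime] [CharP k p] [CharP L p]
    [IsAlgClosure (LambdaMin k) L] {α : ℕ → L}
    (hα : ∀ i, α i ^ p - α i = algebraMap (LambdaMin k) L (singleMin (-asExp i) 1)) (N : ℕ) :
    ∃ n, N ≤ n ∧ ∃ σ : L ≃ₐ[LambdaMin k] L, σ (α n) ≠ α n ∧ ∀ j < n, σ (α j) = α j := by
  classical
  let E : IntermediateField (LambdaMin k) L :=
    IntermediateField.adjoin (LambdaMin k) (α '' Set.Iio N)
  have hfin : FiniteDimensional (LambdaMin k) E := by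
    have : Finite (α '' Set.Iio N) := ((Set.finite_Iio N).image α).to_subtype
    exact IntermediateField.finiteDimensional_adjoin fun x _ => Algebra.IsIntegral.isIntegral x
  -- `E` has finite dimension and the `α n` are independent. For the least `n` with `α n` outside
  -- `E`, automorphisms over `E` fix all earlier `α j`, and `N ≤ n` because `E` contains the first
  -- `N`.
  have hex : ∃ n, α n ∉ E := by
    by_contra! hall
    have hli : LinearIndependent (LambdaMin k) (fun n => (⟨α n, hall n⟩ : E)) :=
      LinearIndependent.of_comp E.val.toLinearMap (linearIndependent_of_pow_sub_self_eq p hα)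
    exact Module.Finite.not_linearIndependent_of_infinite _ hli
  have hlt : ∀ j < Nat.find hex, α j ∈ E := fun j hj => not_not.1 (Nat.find_min hex hj)
  have hNle : N ≤ Nat.find hex := by
    by_contra! h
    exact Nat.find_spec hex (IntermediateField.subset_adjoin _ _ ⟨_, h, rfl⟩)
  have hnormal : Normal E L := Normal.tower_top_of_normal (LambdaMin k) E L
  have hchar : CharP E p :=
    charP_of_injective_ringHom (algebraMap (LambdaMin k) E).injective p
  have hsep : (minpoly E (α (Nat.find hex))).Separable :=
    separable_minpoly_of_pow_sub_self_eq p
      (c := algebraMap (LambdaMin k) E (singleMin (-asExp (Nat.find hex)) 1)) (by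
        rw [hα, ← IsScalarTower.algebraMap_apply])
  obtain ⟨σ, hσ⟩ := exists_algEquiv_apply_ne hsep (by
    rintro ⟨e, he⟩
    exact Nat.find_spec hex (he ▸ e.2))
  exact ⟨Nat.find hex, hNle, σ.restrictScalars (LambdaMin k), hσ,
    fun j hj => σ.commutes ⟨α j, hlt j hj⟩⟩

/-- The sum `z` of `∑ T ^ m * α m` would have conjugates `σ z` with `ν (σ z - z)` equal to
arbitrarily large integers, but an algebraic element has finitely many conjugates. -/
theorem not_isCompleteValued_of_isAlgClosure (p : ℕ) [Fact p.Prime] [CharP k p]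
    [IsAlgClosure (LambdaMin k) L] {ν : AddValuation L (WithTop ℝ)}
    (hν : IsValuedExtension (valMin k) ν (algebraMap (LambdaMin k) L))
    (huniq : ∀ ν' : AddValuation L (WithTop ℝ),
      IsValuedExtension (valMin k) ν' (algebraMap (LambdaMin k) L) → ν' = ν) :
    ¬ IsCompleteValued ν := by
  classical
  intro hcomplete
  have hclosed : IsAlgClosed L := IsAlgClosure.isAlgClosed (LambdaMin k)
  have hchar : CharP L p := charP_of_injective_ringHom (algebraMap (LambdaMin k) L).injective p
  choose α hα using fun i : ℕ => exists_pow_sub_self_eq (E := L) (Fact.out : p.Prime).one_lt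
    (algebraMap (LambdaMin k) L (singleMin (-asExp i) 1))
  have hinv : ∀ (σ : L ≃ₐ[LambdaMin k] L) (x : L), ν (σ x) = ν x := by
    intro σ x
    -- Uniqueness of the extension makes `ν` invariant under automorphisms.
    have h := huniq (ν.comap (σ : L →+* L)) fun a => by
      change ν (σ (algebraMap (LambdaMin k) L a)) = _
      rw [σ.commutes, hν]
    exact DFunLike.congr_fun h x
  have hdiff : ∀ (σ : L ≃ₐ[LambdaMin k] L) (i : ℕ), (σ (α i) - α i) ^ p = σ (α i) - α i := by
    intro σ i
    have h1 : σ (α i) ^ p - σ (α i) = α i ^ p - α i := by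
      rw [← map_pow, ← map_sub, hα, σ.commutes]
    rw [sub_pow_char]
    linear_combination h1
  set T : ℕ → L := fun n => algebraMap (LambdaMin k) L (singleMin (n : ℝ) 1) with hT
  have hνT : ∀ n, ν (T n) = ((n : ℝ) : WithTop ℝ) := fun n => by
    rw [hT, hν, valMin_singleMin one_ne_zero]
  set S : ℕ → L := fun M => ∑ m ∈ Finset.range M, T m * α m with hS
  have htail : ∀ N n : ℕ, N ≤ n → (((N : ℝ) + -2 : ℝ) : WithTop ℝ) ≤ ν (S n - S N) := by
    intro N n hn
    rw [hS, ← Finset.sum_Ico_eq_sub _ hn]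
    refine ν.map_le_sum fun m hm => ?_
    rw [ν.map_mul, hνT, WithTop.coe_add]
    refine add_le_add (WithTop.coe_le_coe.2 ?_) (neg_two_le_val p hν (hα m))
    exact Nat.cast_le.2 (Finset.mem_Ico.1 hm).1
  obtain ⟨z, hz⟩ := (isCompleteValued_iff ν).1 hcomplete S fun c => by
    obtain ⟨N, hN⟩ := exists_nat_gt (c + 2)
    have hcN : (c : WithTop ℝ) < (((N : ℝ) + -2 : ℝ) : WithTop ℝ) :=
      WithTop.coe_lt_coe.2 (by linarith)
    refine ⟨N, fun m n hm hn => hcN.trans_le ?_⟩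
    rw [← sub_sub_sub_cancel_right (S m) (S n) (S N)]
    exact (le_min (htail N m hm) (htail N n hn)).trans (ν.map_sub _ _)
  have hmove : ∀ N : ℕ, ∃ n, N ≤ n ∧ ∃ σ : L ≃ₐ[LambdaMin k] L,
      ν (σ z - z) = ((n : ℝ) : WithTop ℝ) := by
    intro N
    obtain ⟨n, hn, σ, hne, hfix⟩ := exists_algEquiv_moves_first p hα N
    refine ⟨n, hn, σ, ?_⟩
    obtain ⟨M₀, hM₀⟩ := hz n
    -- Large enough that `S M` contains the term of index `n` and is closer to `z` than `n`. In `σ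
    -- (S M) - S M` the terms before `n` vanish and those after it have value above `n`, so the term
    -- of index `n` determines the value.
    set M := max M₀ (n + 1) with hM
    have hzM : ((n : ℝ) : WithTop ℝ) < ν (S M - z) := hM₀ M (le_max_left _ _)
    have hTσ : ∀ m, σ (T m) = T m := fun m => σ.commutes _
    have hsum : σ (S M) - S M = ∑ m ∈ Finset.range M, T m * (σ (α m) - α m) := by
      rw [hS, map_sum, ← Finset.sum_sub_distrib]
      refine Finset.sum_congr rfl fun m _ => ?_
      rw [map_mul, hTσ, mul_sub]
    have hlead : ν (T n * (σ (α n) - α n)) = ((n : ℝ) : WithTop ℝ) := by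
      rw [ν.map_mul, hνT, val_eq_zero_of_pow_eq_self p ν (hdiff σ n) (sub_ne_zero.2 hne), add_zero]
    have hrest : ((n : ℝ) : WithTop ℝ) <
        ν (∑ m ∈ (Finset.range M).erase n, T m * (σ (α m) - α m)) := by
      refine ν.map_lt_sum WithTop.coe_ne_top fun m hm => ?_
      by_cases h0 : σ (α m) - α m = 0
      · rw [h0, mul_zero, ν.map_zero]
        exact WithTop.coe_lt_top _
      · have hmn : n < m := by
          refine lt_of_le_of_ne ?_ (Finset.ne_of_mem_erase hm).symm
          by_contra! hlt
          exact h0 (sub_eq_zero.2 (hfix m hlt))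
        rw [ν.map_mul, hνT, val_eq_zero_of_pow_eq_self p ν (hdiff σ m) h0, add_zero]
        exact WithTop.coe_lt_coe.2 (Nat.cast_lt.2 hmn)
    have hSM : ν (σ (S M) - S M) = ((n : ℝ) : WithTop ℝ) := by
      rw [hsum, ← Finset.add_sum_erase _ _ (Finset.mem_range.2
        (lt_of_lt_of_le (Nat.lt_succ_self n) (le_max_right _ _))),
        ν.map_add_eq_of_lt_left (hlead.trans_lt hrest), hlead]
    have hdecomp : σ z - z = (σ (S M) - S M) + ((S M - z) - σ (S M - z)) := by
      rw [map_sub]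
      ring
    rw [hdecomp, ν.map_add_eq_of_lt_left, hSM]
    rw [hSM]
    refine (lt_min hzM ?_).trans_le (ν.map_sub _ _)
    rw [hinv]
    exact hzM
  have hint : IsIntegral (LambdaMin k) z := Algebra.IsIntegral.isIntegral z
  have hfin : {n : ℕ | ((n : ℝ) : WithTop ℝ) ∈
      (fun y => ν (y - z)) '' (minpoly (LambdaMin k) z).rootSet L}.Finite :=
    (((minpoly (LambdaMin k) z).rootSet_finite L).image _).preimage
      (WithTop.coe_injective.comp Nat.cast_injective).injOn
  obtain ⟨B, hB⟩ := hfin.bddAbove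
  obtain ⟨n, hn, σ, hσ⟩ := hmove (B + 1)
  have hroot : σ z ∈ (minpoly (LambdaMin k) z).rootSet L :=
    Polynomial.mem_rootSet.2 ⟨minpoly.ne_zero hint, by
      rw [Polynomial.aeval_algHom_apply σ z, minpoly.aeval, map_zero]⟩
  have := hB (show n ∈ _ from ⟨σ z, hroot, hσ⟩)
  omega

end Incomplete

end Novikov

end

theorem propositionA6 (k : Type*) [Field k] :
    -- both Novikov fields are perfect
    (PerfectField k →
      PerfectField (Novikov.LambdaMin k) ∧ PerfectField (Novikov.LambdaMax k)) ∧
    -- Krull maximality of the larger field, and algebraic closedness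
    ((∀ (K : Type*) [Field K] (ν : AddValuation K (WithTop ℝ))
        (i : Novikov.LambdaMax k →+* K)
        (hi : Novikov.IsValuedExtension (Novikov.valMax k) ν i),
        Function.Bijective (Novikov.coeffToResidue ν i hi) →
        Novikov.valueGroup ν = Set.univ →
        Function.Surjective i) ∧
      (IsAlgClosed k → IsAlgClosed (Novikov.LambdaMax k))) ∧
    -- the smaller field, characteristic zero
    (CharZero k → IsAlgClosed k → IsAlgClosed (Novikov.LambdaMin k)) ∧
    -- the smaller field, positive characteristic
    (∀ p : ℕ, 0 < p → CharP k p →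
      ¬ IsAlgClosed (Novikov.LambdaMin k) ∧
      ∀ (L : Type*) [Field L] [Algebra (Novikov.LambdaMin k) L]
        [IsAlgClosure (Novikov.LambdaMin k) L],
        ∃ ν : AddValuation L (WithTop ℝ),
          Novikov.IsValuedExtension (Novikov.valMin k) ν (algebraMap (Novikov.LambdaMin k) L) ∧
          (∀ ν' : AddValuation L (WithTop ℝ),
            Novikov.IsValuedExtension (Novikov.valMin k) ν'
              (algebraMap (Novikov.LambdaMin k) L) → ν' = ν) ∧
          ¬ Novikov.IsCompleteValued ν) := by
  refine ⟨fun _ => ⟨Novikov.perfectField_lambdaMin, Novikov.perfectField_lambdaMax⟩,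
    ⟨fun K _ ν i hi hbij _ => Novikov.surjective_of_bijective_coeffToResidue ν i hi hbij,
      fun _ => Novikov.isAlgClosed_lambdaMax⟩,
    fun _ _ => Novikov.isAlgClosed_lambdaMin, fun p hp0 hp => ?_⟩
  have : Fact p.Prime := ⟨(CharP.char_is_prime_or_zero k p).resolve_right hp0.ne'⟩
  refine ⟨Novikov.not_isAlgClosed_lambdaMin p, fun L _ _ _ => ?_⟩
  obtain ⟨ν, hν, huniq, -⟩ := Novikov.exists_unique_extension (L := L) (Novikov.valMin k)
    Novikov.isCompleteValued_valMin Novikov.exists_valMin_ne_zero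
  exact ⟨ν, hν, huniq, Novikov.not_isCompleteValued_of_isAlgClosure p hν huniq⟩
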